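/- Let $E$ be a (real) reflexive Banach lattice that is disjointly homogeneous, i.e. for every pair $(x_n)$, $(y_n)$ of sequences of norm-one, pairwise disjoint elements of $E$ there are $C>0$ and a subsequence $(n_k)$ such that $$C^{-1}\Bigl\|\sum_k a_k y_{n_k}\Bigr\|\le\Bigl\|\sum_k a_k x_{n_k}\Bigr\|\le C\Bigl\|\sum_k a_k y_{n_k}\Bigr\|$$ for all (equivalently, all finitely supported) scalar sequences $(a_k)$. Let $T:E\to E$ be a positive bounded linear operator, i.e. $Tx\ge 0$ whenever $x\ge 0$. Then the following are equivalent: 1. $T$ is disjointly strictly singular: for every sequence $(x_n)$ of nonzero pairwise disjoint elements of $E$, the restriction of $T$ to the closed linear span $[x_n]$ is not an isomorphism onto its image. 2. $T$ is M-weakly compact: $\|Tx_n\|\to 0$ for every pairwise disjoint sequence $(x_n)$ in the closed unit ball $B_E$. 3. $T$ is L-weakly compact: $\|y_n\|\to 0$ for every pairwise disjoint sequence $(y_n)$ in the solid hull $\{y\in E: |y|\le |Tx| \text{ for some } x\in B_E\}$ of $T(B_E)$. Here $x,y\in E$ are disjoint if $|x|\wedge|y|=0$. -/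

import Mathlib

open Filter Topology

namespace DHLattice

/-- The space is reflexive: the canonical map into the bidual is onto. -/
def IsReflexive (X : Type*) [NormedAddCommGroup X] [NormedSpace ℝ X] : Prop :=
  Function.Surjective (NormedSpace.inclusionInDoubleDual ℝ X)

/-- Pairwise disjoint sequence in a Banach lattice: `|x i| ∧ |x j| = 0` for `i ≠ j`. -/
def DisjointSeq {E : Type*} [NormedAddCommGroup E] [Lattice E] (x : ℕ → E) : Prop :=
  ∀ i j : ℕ, i ≠ j → |x i| ⊓ |x j| = 0

/-- `C`-equivalence of two sequences. It is stated for finitely supported scalar families;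
by completeness this is the same as: for every scalar sequence `a`, the series `∑ a n • x n` and
`∑ a n • y n` converge simultaneously, and the two inequalities hold for their sums. -/
def EquivSeq {X Y : Type*} [NormedAddCommGroup X] [NormedSpace ℝ X]
    [NormedAddCommGroup Y] [NormedSpace ℝ Y] (C : ℝ) (x : ℕ → X) (y : ℕ → Y) : Prop :=
  ∀ (s : Finset ℕ) (a : ℕ → ℝ),
    C⁻¹ * ‖∑ n ∈ s, a n • y n‖ ≤ ‖∑ n ∈ s, a n • x n‖ ∧
      ‖∑ n ∈ s, a n • x n‖ ≤ C * ‖∑ n ∈ s, a n • y n‖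

/-- Disjointly homogeneous Banach lattice. -/
def IsDisjointlyHomogeneous (E : Type*) [NormedAddCommGroup E] [NormedSpace ℝ E] [Lattice E] :
    Prop :=
  ∀ x y : ℕ → E, (∀ n, ‖x n‖ = 1) → (∀ n, ‖y n‖ = 1) → DisjointSeq x → DisjointSeq y →
    ∃ C : ℝ, 0 < C ∧ ∃ φ : ℕ → ℕ, StrictMono φ ∧
      EquivSeq C (fun k => x (φ k)) (fun k => y (φ k))

/-- The closed linear span `[x n]` of a sequence. -/
def closedSpan {X : Type*} [NormedAddCommGroup X] [NormedSpace ℝ X] (x : ℕ → X) :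
    Submodule ℝ X :=
  (Submodule.span ℝ (Set.range x)).topologicalClosure

/-- `T` is invertible on the subspace `M`: its restriction to `M` is an isomorphism onto
its image, that is, it is bounded below on `M`. -/
def InvertibleOn {X Y : Type*} [NormedAddCommGroup X] [NormedSpace ℝ X]
    [NormedAddCommGroup Y] [NormedSpace ℝ Y] (T : X →L[ℝ] Y) (M : Submodule ℝ X) : Prop :=
  ∃ c : ℝ, 0 < c ∧ ∀ x ∈ M, c * ‖x‖ ≤ ‖T x‖

/-- Disjointly strictly singular operator. The elements of the disjoint sequences are nonzero
(otherwise the span could be finite-dimensional). -/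
def IsDisjointlyStrictlySingular {E X : Type*} [NormedAddCommGroup E] [NormedSpace ℝ E]
    [Lattice E] [NormedAddCommGroup X] [NormedSpace ℝ X] (T : E →L[ℝ] X) : Prop :=
  ∀ x : ℕ → E, (∀ n, x n ≠ 0) → DisjointSeq x → ¬ InvertibleOn T (closedSpan x)

/-- M-weakly compact operator. -/
def IsMWeaklyCompact {E X : Type*} [NormedAddCommGroup E] [NormedSpace ℝ E]
    [Lattice E] [NormedAddCommGroup X] [NormedSpace ℝ X] (T : E →L[ℝ] X) : Prop :=
  ∀ x : ℕ → E, (∀ n, x n ∈ Metric.closedBall (0 : E) 1) → DisjointSeq x →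
    Tendsto (fun n => T (x n)) atTop (𝓝 0)

/-- L-weakly compact operator. -/
def IsLWeaklyCompact {X E : Type*} [NormedAddCommGroup X] [NormedSpace ℝ X]
    [NormedAddCommGroup E] [NormedSpace ℝ E] [Lattice E] (T : X →L[ℝ] E) : Prop :=
  ∀ y : ℕ → E,
    (∀ n, y n ∈ LatticeOrderedAddCommGroup.solidClosure (T '' Metric.closedBall (0 : X) 1)) →
    DisjointSeq y → Tendsto y atTop (𝓝 0)

/-- Positive operator: it maps positive elements to positive elements. -/
def IsPositiveOp {E F : Type*} [NormedAddCommGroup E] [NormedSpace ℝ E] [Lattice E]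
    [NormedAddCommGroup F] [NormedSpace ℝ F] [Lattice F] (T : E →L[ℝ] F) : Prop :=
  ∀ x : E, 0 ≤ x → 0 ≤ T x

end DHLattice

set_option linter.unusedSectionVars false

/-! Reflexivity makes the norm order continuous and bounded disjoint positive sequences weakly null.
If `T` is not M-weakly compact, some normalized disjoint positive `w k` have `‖T (w k)‖ ≥ ε`. The
images `T (w k)` are positive and weakly null, hence norm null after truncation by any fixed `u ≥ 0`
(`IsReflexive.tendsto_inf_zero`), so a subsequence is a small perturbation of a disjoint sequence
`z` (`exists_subseq_near_disjoint`). Disjoint homogeneity compares `w` with the normalized `z`, and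
`z` is dominated by `T w`; hence `T` is bounded below on a disjoint span and is not disjointly
strictly singular. The converse is immediate by normalizing. M- and L-weak compactness are linked by
`exists_norm_map_posPart_sub_le`: nullity along disjoint sequences forces almost order boundedness.
The bounded part is then killed by order continuity in one direction and by the truncation lemma in
the other. -/

namespace DHLattice

/-! ### Disjointness in vector lattices -/

section Lattice

variable {E : Type*} [AddCommGroup E] [Lattice E] [IsOrderedAddMonoid E]

theorem inf_add_le_add_inf {a b c : E} (ha : 0 ≤ a) (hb : 0 ≤ b) (hc : 0 ≤ c) :
    a ⊓ (b + c) ≤ a ⊓ b + a ⊓ c := by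
  rw [add_inf, inf_add, inf_add]
  refine le_inf (le_inf ?_ ?_) (le_inf ?_ ?_)
  · exact inf_le_left.trans (le_add_of_nonneg_left ha)
  · exact inf_le_left.trans (le_add_of_nonneg_left hb)
  · exact inf_le_left.trans (le_add_of_nonneg_right hc)
  · exact inf_le_right

theorem le_inf_add_of_le_add {y a b : E} (hb : 0 ≤ b) (h : y ≤ a + b) : y ≤ y ⊓ a + b := by
  rw [inf_add]
  exact le_inf (le_add_of_nonneg_right hb) h

theorem inf_add_eq_zero {a b c : E} (hb : 0 ≤ b) (hc : 0 ≤ c)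
    (hab : a ⊓ b = 0) (hac : a ⊓ c = 0) : a ⊓ (b + c) = 0 := by
  have ha : 0 ≤ a := hab ▸ inf_le_left
  refine le_antisymm ((inf_add_le_add_inf ha hb hc).trans ?_) (le_inf ha (add_nonneg hb hc))
  simp [hab, hac]

theorem inf_sum_eq_zero {ι : Type*} (s : Finset ι) {a : E} (ha : 0 ≤ a) {b : ι → E}
    (hb : ∀ i ∈ s, 0 ≤ b i) (hab : ∀ i ∈ s, a ⊓ b i = 0) : a ⊓ ∑ i ∈ s, b i = 0 := by
  classical
  induction s using Finset.induction_on with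
  | empty => simpa using ha
  | insert i s hi ih =>
    rw [Finset.sum_insert hi]
    refine inf_add_eq_zero (hb i (by simp)) (Finset.sum_nonneg fun j hj => hb j (by simp [hj]))
      (hab i (by simp)) (ih (fun j hj => hb j (by simp [hj])) fun j hj => hab j (by simp [hj]))

theorem abs_add_of_disjoint {a b : E} (h : |a| ⊓ |b| = 0) : |a + b| = |a| + |b| := by
  refine le_antisymm (abs_add_le a b) ?_
  have h1 : |(|a| - |(-b)|)| ≤ |a - (-b)| := abs_abs_sub_abs_le a (-b)
  rw [abs_neg, sub_neg_eq_add, abs_sub_comm, ← sup_sub_inf_eq_abs_sub, h, sub_zero] at h1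
  have h2 := inf_add_sup |a| |b|
  rw [h, zero_add] at h2
  rwa [← h2]

theorem inf_eq_zero_mono {a b a' b' : E} (h : a ⊓ b = 0) (ha : 0 ≤ a') (hb : 0 ≤ b')
    (haa : a' ≤ a) (hbb : b' ≤ b) : a' ⊓ b' = 0 :=
  le_antisymm ((inf_le_inf haa hbb).trans h.le) (le_inf ha hb)

/-- For disjoint positive elements the sum is the supremum. -/
theorem sum_range_le_of_disjoint {z : ℕ → E} {u : E} (hu : 0 ≤ u) (hz : ∀ n, 0 ≤ z n)
    (hzu : ∀ n, z n ≤ u) (hd : ∀ i j, i ≠ j → z i ⊓ z j = 0) (n : ℕ) :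
    ∑ i ∈ Finset.range n, z i ≤ u := by
  induction n with
  | zero => simpa using hu
  | succ n ih =>
    have h0 : z n ⊓ ∑ i ∈ Finset.range n, z i = 0 :=
      inf_sum_eq_zero _ (hz n) (fun i _ => hz i)
        fun i hi => hd n i (Finset.mem_range.1 hi).ne'
    have h2 := inf_add_sup (z n) (∑ i ∈ Finset.range n, z i)
    rw [h0, zero_add] at h2
    rw [Finset.sum_range_succ, add_comm, ← h2]
    exact sup_le (hzu n) ih

variable [Module ℝ E] [IsOrderedModule ℝ E]

theorem smul_inf_of_pos {c : ℝ} (hc : 0 < c) (a b : E) : c • (a ⊓ b) = c • a ⊓ c • b :=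
  (OrderIso.smulRight hc).map_inf a b

theorem smul_sup_of_nonneg {c : ℝ} (hc : 0 ≤ c) (a b : E) : c • (a ⊔ b) = c • a ⊔ c • b := by
  rcases hc.eq_or_lt with rfl | hc
  · simp
  · exact (OrderIso.smulRight hc).map_sup a b

theorem smul_posPart {c : ℝ} (hc : 0 ≤ c) (a : E) : (c • a)⁺ = c • a⁺ := by
  rw [posPart_def, posPart_def, smul_sup_of_nonneg hc, smul_zero]

theorem abs_smul_eq (c : ℝ) (a : E) : |c • a| = |c| • |a| := by
  have key : ∀ {c : ℝ}, 0 ≤ c → |c • a| = c • |a| := fun {c} hc => by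
    simp only [abs, smul_sup_of_nonneg hc, smul_neg]
  rcases le_total 0 c with hc | hc
  · rw [key hc, abs_of_nonneg hc]
  · rw [abs_of_nonpos hc, ← key (neg_nonneg.2 hc), neg_smul, abs_neg]

theorem inf_smul_eq_zero {a b : E} {c : ℝ} (hc : 0 ≤ c) (hab : a ⊓ b = 0) : a ⊓ c • b = 0 := by
  have ha : 0 ≤ a := hab ▸ inf_le_left
  have hb : 0 ≤ b := hab ▸ inf_le_right
  -- The common factor `c + 1` dominates both coefficients `1` and `c`.
  have h1 : (c + 1) • a ⊓ (c + 1) • b = 0 := by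
    rw [← smul_inf_of_pos (by positivity), hab, smul_zero]
  refine inf_eq_zero_mono h1 ha (smul_nonneg hc hb) ?_ ?_
  · rw [add_smul, one_smul]
    exact le_add_of_nonneg_left (smul_nonneg hc ha)
  · rw [add_smul, one_smul]
    exact le_add_of_nonneg_right hb

theorem smul_inf_smul_eq_zero {a b : E} {c d : ℝ} (hc : 0 ≤ c) (hd : 0 ≤ d) (hab : a ⊓ b = 0) :
    c • a ⊓ d • b = 0 := by
  refine inf_smul_eq_zero hd ?_
  rw [inf_comm] at hab ⊢
  exact inf_smul_eq_zero hc hab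

theorem abs_sum_smul_of_disjoint {z : ℕ → E} (hz : ∀ n, 0 ≤ z n)
    (hd : ∀ i j, i ≠ j → z i ⊓ z j = 0) (a : ℕ → ℝ) (s : Finset ℕ) :
    |∑ n ∈ s, a n • z n| = ∑ n ∈ s, |a n| • z n := by
  induction s using Finset.induction_on with
  | empty => simp
  | insert i s hi ih =>
    have e : |a i • z i| = |a i| • z i := by rw [abs_smul_eq, abs_of_nonneg (hz i)]
    rw [Finset.sum_insert hi, Finset.sum_insert hi, abs_add_of_disjoint, ih, e]
    rw [ih, e]
    refine inf_sum_eq_zero _ (smul_nonneg (abs_nonneg _) (hz i))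
      (fun j _ => smul_nonneg (abs_nonneg _) (hz j)) fun j hj => ?_
    exact smul_inf_smul_eq_zero (abs_nonneg _) (abs_nonneg _)
      (hd i j fun h => hi (h ▸ hj))

/-- The positive parts of `a - c • b` and `b - c⁻¹ • a` are disjoint. -/
theorem posPart_sub_smul_inf_eq_zero {c : ℝ} (hc : 0 < c) (a b : E) :
    (a - c • b)⁺ ⊓ (b - c⁻¹ • a)⁺ = 0 := by
  have h : (a - c • b)⁺ ⊓ (c • b - a)⁺ = 0 := by
    have := posPart_inf_negPart_eq_zero (a - c • b)
    rwa [← posPart_neg, neg_sub] at this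
  have e : b - c⁻¹ • a = c⁻¹ • (c • b - a) := by
    rw [smul_sub, smul_smul, inv_mul_cancel₀ hc.ne', one_smul]
  rw [e, smul_posPart (by positivity)]
  exact inf_smul_eq_zero (by positivity) h

end Lattice

/-! ### Reflexivity: weak cluster points and order continuity -/

section Reflexive

/-- In a reflexive space a bounded sequence has a point that lies in every closed convex set
containing a tail of the sequence. -/
theorem IsReflexive.exists_mem_of_eventually_mem {X : Type*} [NormedAddCommGroup X]
    [NormedSpace ℝ X] (hX : IsReflexive X) {x : ℕ → X} {B : ℝ} (hB : ∀ n, ‖x n‖ ≤ B) :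
    ∃ x₀ : X, ∀ C : Set X, Convex ℝ C → IsClosed C → (∀ᶠ n in atTop, x n ∈ C) → x₀ ∈ C := by
  -- Limits along a free ultrafilter define a bounded functional on the dual; reflexivity represents
  -- it by a point, and Hahn-Banach separation places that point in each set.
  let U : Ultrafilter ℕ := hyperfilter ℕ
  have hU : (U : Filter ℕ) ≤ atTop := Nat.hyperfilter_le_atTop
  have hlim : ∀ f : StrongDual ℝ X, ∃ l : ℝ, Tendsto (fun n => f (x n)) U (𝓝 l) := fun f => by
    have hmem : ∀ n, f (x n) ∈ Metric.closedBall (0 : ℝ) (‖f‖ * B) := fun n => by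
      rw [mem_closedBall_zero_iff]
      exact (f.le_opNorm _).trans (mul_le_mul_of_nonneg_left (hB n) (norm_nonneg _))
    obtain ⟨l, _, hl⟩ := (isCompact_closedBall (0 : ℝ) (‖f‖ * B)).ultrafilter_le_nhds
      (U.map fun n => f (x n)) (by
        rw [le_principal_iff]
        exact Filter.mem_map.2 (Filter.univ_mem' hmem))
    exact ⟨l, hl⟩
  choose Φ hΦ using hlim
  let Ψ : StrongDual ℝ X →ₗ[ℝ] ℝ :=
    { toFun := Φ
      map_add' := fun f g => tendsto_nhds_unique (hΦ (f + g)) ((hΦ f).add (hΦ g))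
      map_smul' := fun c f => tendsto_nhds_unique (hΦ (c • f)) ((hΦ f).const_mul c) }
  have hΨ : ∀ f, ‖Ψ f‖ ≤ B * ‖f‖ := fun f => by
    refine le_of_tendsto (hΦ f).norm (Eventually.of_forall fun n => ?_)
    rw [mul_comm]
    exact (f.le_opNorm _).trans (mul_le_mul_of_nonneg_left (hB n) (norm_nonneg _))
  obtain ⟨x₀, hx₀⟩ := hX (Ψ.mkContinuous B hΨ)
  have hx : ∀ f : StrongDual ℝ X, f x₀ = Φ f := fun f => by
    simpa using! DFunLike.congr_fun hx₀ f
  refine ⟨x₀, fun C hC hcl hev => ?_⟩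
  by_contra hn
  obtain ⟨f, u, hu, hux⟩ := geometric_hahn_banach_closed_point hC hcl hn
  rw [hx] at hux
  exact absurd (le_of_tendsto (hΦ f) ((hev.filter_mono hU).mono fun n h => (hu _ h).le))
    (not_le.2 hux)

variable {E : Type*} [NormedAddCommGroup E] [NormedSpace ℝ E]
    [Lattice E] [IsOrderedAddMonoid E] [IsOrderedModule ℝ E] [HasSolidNorm E]

theorem norm_le_norm_of_nonneg_of_le {a b : E} (ha : 0 ≤ a) (h : a ≤ b) : ‖a‖ ≤ ‖b‖ :=
  norm_le_norm_of_abs_le_abs (abs_le_abs_of_nonneg ha h)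

/-- A weak cluster point `x` is an upper bound lying in the closed convex hull. Each convex
combination `c` is below some `s N`, so `0 ≤ x - s m ≤ x - c` for `m ≥ N`, and weak approximation
becomes norm convergence. -/
theorem IsReflexive.tendsto_of_monotone (hE : IsReflexive E) {s : ℕ → E} (hs : Monotone s)
    {B : ℝ} (hB : ∀ n, ‖s n‖ ≤ B) : ∃ l, Tendsto s atTop (𝓝 l) := by
  obtain ⟨x, hx⟩ := hE.exists_mem_of_eventually_mem hB
  have hle : ∀ n, s n ≤ x := fun n =>
    hx (Set.Ici (s n)) (convex_Ici (𝕜 := ℝ) _) isClosed_Ici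
      ((eventually_ge_atTop n).mono fun m hm => hs hm)
  have hcl : x ∈ closure (convexHull ℝ (Set.range s)) :=
    hx _ (convex_convexHull ℝ _).closure isClosed_closure
      (Eventually.of_forall fun n => subset_closure (subset_convexHull ℝ _ ⟨n, rfl⟩))
  have hsub : convexHull ℝ (Set.range s) ⊆ {c | ∃ N, c ≤ s N} := by
    refine convexHull_min (by rintro _ ⟨n, rfl⟩; exact ⟨n, le_rfl⟩) ?_
    rintro c ⟨N, hN⟩ d ⟨M, hM⟩ a b ha hb hab
    refine ⟨max N M, ?_⟩
    calc a • c + b • d ≤ a • s (max N M) + b • s (max N M) :=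
          add_le_add (smul_le_smul_of_nonneg_left (hN.trans (hs (le_max_left _ _))) ha)
            (smul_le_smul_of_nonneg_left (hM.trans (hs (le_max_right _ _))) hb)
      _ = s (max N M) := by rw [← add_smul, hab, one_smul]
  refine ⟨x, Metric.tendsto_atTop.2 fun ε hε => ?_⟩
  obtain ⟨c, hc, hxc⟩ := Metric.mem_closure_iff.1 hcl ε hε
  obtain ⟨N, hN⟩ := hsub hc
  refine ⟨N, fun m hm => ?_⟩
  rw [dist_comm, dist_eq_norm]
  rw [dist_eq_norm] at hxc
  exact (norm_le_norm_of_nonneg_of_le (sub_nonneg.2 (hle m))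
    (sub_le_sub_left (hN.trans (hs hm)) x)).trans_lt hxc

theorem IsReflexive.tendsto_of_antitone (hE : IsReflexive E) {s : ℕ → E} (hs : Antitone s)
    (h0 : ∀ n, 0 ≤ s n) : ∃ l, Tendsto s atTop (𝓝 l) := by
  obtain ⟨l, hl⟩ := hE.tendsto_of_monotone (s := fun n => - s n) (B := ‖s 0‖)
    (fun i j h => neg_le_neg (hs h)) fun n => by
      rw [norm_neg]
      exact norm_le_norm_of_nonneg_of_le (h0 n) (hs (Nat.zero_le n))
  exact ⟨-l, by simpa using hl.neg⟩

/-- The norm of a reflexive Banach lattice is order continuous: order bounded disjoint sequences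
converge to zero. -/
theorem IsReflexive.tendsto_zero_of_disjoint_of_le (hE : IsReflexive E) {z : ℕ → E} {u : E}
    (hz : ∀ n, 0 ≤ z n) (hzu : ∀ n, z n ≤ u) (hd : ∀ i j, i ≠ j → z i ⊓ z j = 0) :
    Tendsto z atTop (𝓝 0) := by
  have hu : 0 ≤ u := (hz 0).trans (hzu 0)
  have hle := sum_range_le_of_disjoint hu hz hzu hd
  obtain ⟨l, hl⟩ := hE.tendsto_of_monotone (s := fun n => ∑ i ∈ Finset.range n, z i) (B := ‖u‖)
    (monotone_nat_of_le_succ fun n => by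
      rw [Finset.sum_range_succ]; exact le_add_of_nonneg_right (hz n))
    fun n => norm_le_norm_of_nonneg_of_le (Finset.sum_nonneg fun i _ => hz i) (hle n)
  have h := ((tendsto_add_atTop_iff_nat 1).2 hl).sub hl
  simpa [Finset.sum_range_succ] using h

theorem convex_isClosed_disjoint (a : E) :
    Convex ℝ {x : E | 0 ≤ x ∧ a ⊓ x = 0} ∧ IsClosed {x : E | 0 ≤ x ∧ a ⊓ x = 0} := by
  refine ⟨?_, ?_⟩
  · rintro x ⟨hx, hax⟩ y ⟨hy, hay⟩ s t hs ht -
    exact ⟨add_nonneg (smul_nonneg hs hx) (smul_nonneg ht hy),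
      inf_add_eq_zero (smul_nonneg hs hx) (smul_nonneg ht hy) (inf_smul_eq_zero hs hax)
        (inf_smul_eq_zero ht hay)⟩
  · exact isClosed_Ici.inter (isClosed_eq (continuous_const.inf continuous_id) continuous_const)

/-- Bounded disjoint positive sequences in a reflexive Banach lattice are weakly null. -/
theorem IsReflexive.tendsto_apply_zero_of_disjoint (hE : IsReflexive E) {z : ℕ → E} {B : ℝ}
    (hz : ∀ n, 0 ≤ z n) (hB : ∀ n, ‖z n‖ ≤ B) (hd : ∀ i j, i ≠ j → z i ⊓ z j = 0)
    (f : StrongDual ℝ E) (hf : ∀ x, 0 ≤ x → 0 ≤ f x) :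
    Tendsto (fun n => f (z n)) atTop (𝓝 0) := by
  by_contra hn
  obtain ⟨ε, hε, hfr⟩ : ∃ ε > 0, ∃ᶠ n in atTop, ε ≤ f (z n) := by
    by_contra! h
    refine hn (Metric.tendsto_nhds.2 fun ε hε => ?_)
    filter_upwards [h ε hε] with n hn
    rw [Real.dist_0_eq_abs, abs_of_nonneg (hf _ (hz n))]
    exact hn
  obtain ⟨φ, hφ, hφε⟩ := extraction_of_frequently_atTop hfr
  obtain ⟨x, hx⟩ := hE.exists_mem_of_eventually_mem (x := fun n => z (φ n)) fun n => hB _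
  have h1 : ε ≤ f x := hx {y | ε ≤ f y} (convex_halfSpace_ge f.toLinearMap.isLinear ε)
    (isClosed_le continuous_const f.continuous) (Eventually.of_forall hφε)
  -- The tail past `m` is disjoint from `z (φ m)`, hence so is `x`; then the whole sequence is
  -- disjoint from `x`, so `x` is disjoint from itself.
  have h2 : ∀ m, x ⊓ z (φ m) = 0 := fun m => by
    rw [inf_comm]
    refine (hx _ (convex_isClosed_disjoint (z (φ m))).1 (convex_isClosed_disjoint (z (φ m))).2
      ((eventually_gt_atTop m).mono fun n hmn => ⟨hz _, hd _ _ (hφ hmn).ne⟩)).2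
  have h3 : x ⊓ x = 0 := (hx _ (convex_isClosed_disjoint x).1 (convex_isClosed_disjoint x).2
    (Eventually.of_forall fun n => ⟨hz _, h2 n⟩)).2
  rw [inf_idem] at h3
  rw [h3, map_zero] at h1
  exact absurd h1 (not_le.2 hε)

end Reflexive

/-! ### Positive functionals and truncation of weakly null sequences -/

section Functional

variable {E : Type*} [NormedAddCommGroup E] [NormedSpace ℝ E]
    [Lattice E] [IsOrderedAddMonoid E] [IsOrderedModule ℝ E] [HasSolidNorm E]

/-- A positive element of a normed lattice is normed by a positive functional. -/
theorem exists_positive_norming (d : E) (hd : 0 ≤ d) :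
    ∃ f : StrongDual ℝ E, (∀ x, 0 ≤ x → 0 ≤ f x) ∧ ‖f‖ ≤ 1 ∧ f d = ‖d‖ := by
  rcases eq_or_ne d 0 with rfl | hd0
  · exact ⟨0, fun x _ => le_rfl, by simp, by simp⟩
  -- Domination by `‖x⁺‖` rather than `‖x‖` forces the extension to be positive.
  obtain ⟨g, hg, hgN⟩ := exists_extension_of_le_sublinear
    (LinearPMap.mkSpanSingleton d (‖d‖ : ℝ) hd0) (fun x => ‖x⁺‖)
    (fun c hc x => by
      rw [smul_posPart hc.le, norm_smul, Real.norm_of_nonneg hc.le])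
    (fun x y => by
      refine (norm_le_norm_of_nonneg_of_le (posPart_nonneg _) ?_).trans (norm_add_le x⁺ y⁺)
      rw [posPart_def]
      exact sup_le (add_le_add (le_posPart x) (le_posPart y))
        (add_nonneg (posPart_nonneg _) (posPart_nonneg _)))
    (by
      rintro ⟨x, hx⟩
      obtain ⟨c, rfl⟩ := Submodule.mem_span_singleton.1 hx
      refine (LinearPMap.mkSpanSingleton'_apply d ‖d‖ _ c hx).trans_le ?_
      change c • ‖d‖ ≤ ‖(c • d)⁺‖
      rcases le_total 0 c with hc | hc
      · rw [smul_posPart hc, posPart_of_nonneg hd, norm_smul, Real.norm_of_nonneg hc, smul_eq_mul]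
      · exact (smul_nonpos_of_nonpos_of_nonneg hc (norm_nonneg _)).trans (norm_nonneg _))
  have hle : ∀ x : E, ‖x⁺‖ ≤ ‖x‖ := fun x => by
    rw [← norm_abs_eq_norm x]
    exact norm_le_norm_of_nonneg_of_le (posPart_nonneg _)
      (by rw [posPart_def]; exact sup_le (le_abs_self x) (abs_nonneg x))
  refine ⟨g.mkContinuous 1 fun x => ?_, fun x hx => ?_, ?_, ?_⟩
  · rw [one_mul, Real.norm_eq_abs, abs_le']
    refine ⟨(hgN x).trans (hle x), ?_⟩
    rw [← map_neg, ← norm_neg x]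
    exact (hgN _).trans (hle _)
  · have := hgN (-x)
    rw [posPart_of_nonpos (neg_nonpos.2 hx), norm_zero, map_neg] at this
    simpa using this
  · exact LinearMap.mkContinuous_norm_le _ zero_le_one _
  · have := hg ⟨d, Submodule.mem_span_singleton_self d⟩
    rw [LinearPMap.mkSpanSingleton_apply] at this
    simpa using this

/-- There is a positive functional that is strictly positive on the closure of a given countable
set of positive elements. -/
theorem exists_strictlyPositive_on_closure (d : ℕ → E) (hd : ∀ n, 0 ≤ d n) :
    ∃ F : StrongDual ℝ E, (∀ x, 0 ≤ x → 0 ≤ F x) ∧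
      ∀ v, 0 ≤ v → v ∈ closure (Set.range d) → F v = 0 → v = 0 := by
  choose f hf hf1 hfd using fun n => exists_positive_norming (d n) (hd n)
  have hsum : Summable fun n => ((1 / 2 : ℝ) ^ n) • f n := by
    refine Summable.of_norm_bounded summable_geometric_two fun n => ?_
    rw [norm_smul, Real.norm_of_nonneg (by positivity)]
    exact mul_le_of_le_one_right (by positivity) (hf1 n)
  have hval : ∀ x, HasSum (fun n => (1 / 2 : ℝ) ^ n * f n x)
      ((∑' n, ((1 / 2 : ℝ) ^ n) • f n) x) := fun x => by
    simpa using hsum.hasSum.mapL (ContinuousLinearMap.apply ℝ ℝ x)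
  have hnn : ∀ x, 0 ≤ x → ∀ n, 0 ≤ (1 / 2 : ℝ) ^ n * f n x := fun x hx n =>
    mul_nonneg (by positivity) (hf n x hx)
  refine ⟨∑' n, ((1 / 2 : ℝ) ^ n) • f n, fun x hx => (hval x).nonneg (hnn x hx),
    fun v hv hcl h0 => ?_⟩
  have hz : ∀ n, f n v = 0 := fun n => by
    have h := hval v
    rw [h0, hasSum_zero_iff_of_nonneg (hnn v hv)] at h
    simpa using congr_fun h n
  by_contra hne
  obtain ⟨_, ⟨n, rfl⟩, hn⟩ := Metric.mem_closure_iff.1 hcl (‖v‖ / 2) (by positivity)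
  rw [dist_eq_norm] at hn
  -- Since `f n` norms `d n` but kills `v`, a point `d n` within `‖v‖ / 2` of `v` would give `‖v‖ <
  -- ‖v‖`.
  have h1 : ‖d n‖ ≤ ‖v - d n‖ := by
    rw [norm_sub_rev]
    calc ‖d n‖ = f n (d n - v) := by rw [map_sub, hz, sub_zero, hfd]
      _ ≤ ‖f n‖ * ‖d n - v‖ := (le_abs_self _).trans ((f n).le_opNorm _)
      _ ≤ ‖d n - v‖ := mul_le_of_le_one_left (norm_nonneg _) (hf1 n)
  have h2 := norm_sub_norm_le v (v - d n)
  rw [sub_sub_cancel] at h2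
  linarith

/-- In a reflexive Banach lattice, order bounded positive weakly null sequences are null. -/
theorem IsReflexive.tendsto_inf_zero (hE : IsReflexive E) {y : ℕ → E} (hy : ∀ n, 0 ≤ y n)
    (hw : ∀ f : StrongDual ℝ E, (∀ x, 0 ≤ x → 0 ≤ f x) → Tendsto (fun n => f (y n)) atTop (𝓝 0))
    {u : E} (hu : 0 ≤ u) : Tendsto (fun n => y n ⊓ u) atTop (𝓝 0) := by
  by_contra hn
  set w : ℕ → E := fun n => y n ⊓ u with hwdef
  have hw0 : ∀ n, 0 ≤ w n := fun n => le_inf (hy n) hu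
  obtain ⟨ε, hε, hfr⟩ : ∃ ε > 0, ∃ᶠ n in atTop, ε ≤ ‖w n‖ := by
    by_contra! h
    refine hn (Metric.tendsto_nhds.2 fun ε hε => ?_)
    simpa using h ε hε
  -- Finite suprema of the `w k` form a countable set whose closure contains every limit taken
  -- below, so one functional `F` detects them all.
  let D : List ℕ → E := fun l => l.foldr (fun k a => w k ⊔ a) 0
  have hD0 : ∀ l, 0 ≤ D l := fun l => by
    induction l with
    | nil => exact le_rfl
    | cons k l ih => exact ih.trans le_sup_right
  obtain ⟨F, hF, hFs⟩ := exists_strictlyPositive_on_closure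
    (fun n => D (Denumerable.ofNat (List ℕ) n)) fun n => hD0 _
  have hrange : Set.range (fun n => D (Denumerable.ofNat (List ℕ) n)) = Set.range D :=
    (Denumerable.eqv (List ℕ)).symm.surjective.range_comp D
  rw [hrange] at hFs
  have hFmono : ∀ {a b : E}, a ≤ b → F a ≤ F b := fun {a b} h => by
    have := hF _ (sub_nonneg.2 h)
    rwa [map_sub, sub_nonneg] at this
  have hFw : Tendsto (fun n => F (w n)) atTop (𝓝 0) :=
    squeeze_zero (fun n => hF _ (hw0 n)) (fun n => hFmono inf_le_left) (hw F hF)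
  obtain ⟨φ, hφ, hφε⟩ := extraction_forall_of_frequently
    (P := fun k n => ε ≤ ‖w n‖ ∧ F (w n) < (1 / 2 : ℝ) ^ k)
    fun k => hfr.and_eventually (hFw.eventually (gt_mem_nhds (by positivity)))
  -- The tail suprema `v n = lim S n` decrease to some `l` with `F l = 0`, so `l = 0`; yet `v n ≥ w
  -- (φ n)` keeps their norms at least `ε`.
  let S : ℕ → ℕ → E := fun n => partialSups fun k => w (φ (n + k))
  have hSmono : ∀ n, Monotone (S n) := fun n => (partialSups fun k => w (φ (n + k))).monotone
  have hS0 : ∀ n N, 0 ≤ S n N := fun n N =>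
    (hw0 _).trans (le_partialSups_of_le (fun k => w (φ (n + k))) (Nat.zero_le N))
  have hSu : ∀ n N, S n N ≤ u := fun n N => partialSups_le _ _ _ fun k _ => inf_le_right
  have hSsucc : ∀ n N, S n (N + 1) = S n N ⊔ w (φ (n + (N + 1))) := fun n N =>
    partialSups_add_one _ N
  have hSD : ∀ n N, S n N ∈ Set.range D := fun n N => by
    induction N with
    | zero =>
      refine ⟨[φ n], ?_⟩
      change w (φ n) ⊔ 0 = partialSups (fun k => w (φ (n + k))) 0
      rw [partialSups_zero, sup_eq_left.2 (hw0 _), add_zero]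
    | succ N ih =>
      obtain ⟨l, hl⟩ := ih
      refine ⟨φ (n + (N + 1)) :: l, ?_⟩
      rw [hSsucc, sup_comm, ← hl]
      rfl
  -- The second factor is the partial geometric sum up to exponent `N`.
  have hSF : ∀ n N, F (S n N) ≤ (1 / 2 : ℝ) ^ n * (2 - (1 / 2 : ℝ) ^ N) := fun n N => by
    induction N with
    | zero =>
      have h : S n 0 = w (φ n) := by
        change partialSups (fun k => w (φ (n + k))) 0 = _
        rw [partialSups_zero, add_zero]
      rw [h]
      have := (hφε n).2
      norm_num at this ⊢
      exact this.le
    | succ N ih =>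
      have h1 : F (S n N ⊔ w (φ (n + (N + 1)))) ≤ F (S n N) + F (w (φ (n + (N + 1)))) := by
        rw [← map_add]
        exact hFmono (sup_le (le_add_of_nonneg_right (hw0 _)) (le_add_of_nonneg_left (hS0 n N)))
      have h2 := (hφε (n + (N + 1))).2
      rw [pow_add] at h2
      rw [hSsucc]
      have h3 : (1 / 2 : ℝ) ^ n * (2 - (1 / 2 : ℝ) ^ (N + 1)) =
          (1 / 2 : ℝ) ^ n * (2 - (1 / 2 : ℝ) ^ N) + (1 / 2 : ℝ) ^ n * (1 / 2 : ℝ) ^ (N + 1) := by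
        ring
      rw [h3]
      linarith
  choose v hv using fun n => hE.tendsto_of_monotone (hSmono n) (B := ‖u‖)
    fun N => norm_le_norm_of_nonneg_of_le (hS0 n N) (hSu n N)
  have hv0 : ∀ n, 0 ≤ v n := fun n => ge_of_tendsto' (hv n) (hS0 n)
  have hvanti : Antitone v := antitone_nat_of_succ_le fun n => by
    refine le_of_tendsto_of_tendsto' (hv (n + 1)) ((tendsto_add_atTop_iff_nat 1).2 (hv n))
      fun N => partialSups_le _ _ _ fun k hk => ?_
    have := le_partialSups_of_le (fun k => w (φ (n + k))) (Nat.succ_le_succ hk)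
    rwa [show n + 1 + k = n + (k + 1) by ring]
  obtain ⟨l, hl⟩ := hE.tendsto_of_antitone hvanti hv0
  have hFl : F l = 0 := by
    refine le_antisymm ?_ (hF _ (ge_of_tendsto' hl hv0))
    have hlim : Tendsto (fun n : ℕ => (1 / 2 : ℝ) ^ n * 2) atTop (𝓝 0) := by
      simpa using (tendsto_pow_atTop_nhds_zero_of_lt_one (r := (1 / 2 : ℝ)) (by norm_num)
        (by norm_num)).mul_const 2
    refine le_of_tendsto_of_tendsto' ((F.continuous.tendsto l).comp hl) hlim fun n => ?_
    refine le_of_tendsto' ((F.continuous.tendsto _).comp (hv n)) fun N => (hSF n N).trans ?_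
    have : (0 : ℝ) < (1 / 2 : ℝ) ^ N := by positivity
    gcongr
    linarith
  have hlcl : l ∈ closure (Set.range D) :=
    isClosed_closure.mem_of_tendsto hl (Eventually.of_forall fun n =>
      mem_closure_of_tendsto (hv n) (Eventually.of_forall (hSD n)))
  have hl0 := hFs l (ge_of_tendsto' hl hv0) hlcl hFl
  rw [hl0] at hl
  have hvε : ∀ n, ε ≤ ‖v n‖ := fun n => by
    refine (hφε n).1.trans (norm_le_norm_of_nonneg_of_le (hw0 _) ?_)
    refine ge_of_tendsto' (hv n) fun N => ?_
    exact le_partialSups_of_le (fun k => w (φ (n + k))) (Nat.zero_le N)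
  have := ge_of_tendsto' hl.norm hvε
  rw [norm_zero] at this
  linarith

end Functional

/-! ### Disjointification and almost order boundedness -/

section Disjointification

variable {E : Type*} [NormedAddCommGroup E] [NormedSpace ℝ E] [CompleteSpace E]
    [Lattice E] [IsOrderedAddMonoid E] [IsOrderedModule ℝ E] [HasSolidNorm E]

theorem norm_posPart_sub_posPart_le (a b : E) : ‖a⁺ - b⁺‖ ≤ ‖a - b‖ := by
  simpa [dist_eq_norm] using (lipschitzWith_posPart (α := E)).dist_le_mul a b

/-- Disjointification of a bounded positive sequence. -/
theorem exists_disjoint_near {y : ℕ → E} {B K : ℝ} (hy : ∀ n, 0 ≤ y n) (hB : ∀ n, ‖y n‖ ≤ B)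
    (hK : 0 < K) :
    ∃ z : ℕ → E, (∀ n, 0 ≤ z n) ∧ (∀ i j, i ≠ j → z i ⊓ z j = 0) ∧
      (∀ n, z n ≤ (y n - (K * 4 ^ n) • ∑ i ∈ Finset.range n, y i)⁺) ∧
      ∀ n, ‖(y n - (K * 4 ^ n) • ∑ i ∈ Finset.range n, y i)⁺ - z n‖ ≤
        2 * B / K * (1 / 2) ^ n := by
  have hsum : Summable fun n => ((1 / 2 : ℝ) ^ n) • y n := by
    refine Summable.of_norm_bounded (summable_geometric_two.mul_right B) fun n => ?_
    rw [norm_smul, Real.norm_of_nonneg (by positivity)]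
    exact mul_le_mul_of_nonneg_left (hB n) (by positivity)
  set x : E := ∑' n, ((1 / 2 : ℝ) ^ n) • y n with hx
  have hterm : ∀ n, 0 ≤ ((1 / 2 : ℝ) ^ n) • y n := fun n => smul_nonneg (by positivity) (hy n)
  have hxn : ∀ n, ((1 / 2 : ℝ) ^ n) • y n ≤ x := fun n =>
    hsum.le_tsum n fun j _ => hterm j
  have hx0 : 0 ≤ x := (hterm 0).trans (hxn 0)
  have hxB : ‖x‖ ≤ 2 * B := by
    refine tsum_of_norm_bounded (hasSum_geometric_two.mul_right B) fun n => ?_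
    rw [norm_smul, Real.norm_of_nonneg (by positivity)]
    exact mul_le_mul_of_nonneg_left (hB n) (by positivity)
  let v : ℕ → E := fun n => y n - (K * 4 ^ n) • ∑ i ∈ Finset.range n, y i
  have hs0 : ∀ n, 0 ≤ (K * 4 ^ n) • ∑ i ∈ Finset.range n, y i := fun n =>
    smul_nonneg (by positivity) (Finset.sum_nonneg fun i _ => hy i)
  have ht0 : ∀ n : ℕ, 0 ≤ (K⁻¹ * (1 / 2) ^ n) • x := fun n => smul_nonneg (by positivity) hx0
  -- With `c = (K * 4 ^ j)⁻¹`, the two elements lie below `y i - c • y j` and `y j - c⁻¹ • y i`. The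
  -- factor `4 ^ j` pays both for `y j ≤ 2 ^ j • x` and for the decay `(1 / 2) ^ i`.
  have key : ∀ i j, i < j → (v i - (K⁻¹ * (1 / 2) ^ i) • x)⁺ ⊓
      (v j - (K⁻¹ * (1 / 2) ^ j) • x)⁺ = 0 := fun i j hij => by
    refine inf_eq_zero_mono (posPart_sub_smul_inf_eq_zero (c := (K * 4 ^ j)⁻¹) (by positivity)
      (y i) (y j)) (posPart_nonneg _) (posPart_nonneg _) (posPart_mono ?_) (posPart_mono ?_)
    · refine sub_le_sub (sub_le_self _ (hs0 i)) ?_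
      have h1 : (K * 4 ^ j)⁻¹ ≤ K⁻¹ * (1 / 2) ^ i * (1 / 2 : ℝ) ^ j := by
        rw [mul_inv, mul_assoc]
        refine mul_le_mul_of_nonneg_left ?_ (by positivity)
        have h2 : ((4 : ℝ) ^ j)⁻¹ = (1 / 2) ^ j * (1 / 2) ^ j := by
          rw [← mul_pow, ← inv_pow]; norm_num
        rw [h2]
        exact mul_le_mul_of_nonneg_right
          (pow_le_pow_of_le_one (by norm_num) (by norm_num) hij.le) (by positivity)
      calc (K * 4 ^ j)⁻¹ • y j ≤ (K⁻¹ * (1 / 2) ^ i * (1 / 2 : ℝ) ^ j) • y j :=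
            smul_le_smul_of_nonneg_right h1 (hy j)
        _ = (K⁻¹ * (1 / 2) ^ i) • ((1 / 2 : ℝ) ^ j) • y j := (smul_smul _ _ _).symm
        _ ≤ (K⁻¹ * (1 / 2) ^ i) • x := smul_le_smul_of_nonneg_left (hxn j) (by positivity)
    · refine (sub_le_self _ (ht0 j)).trans (sub_le_sub_left ?_ _)
      rw [inv_inv]
      exact smul_le_smul_of_nonneg_left
        (Finset.single_le_sum (f := y) (fun k _ => hy k) (Finset.mem_range.2 hij)) (by positivity)
  refine ⟨fun n => (v n - (K⁻¹ * (1 / 2) ^ n) • x)⁺, fun n => posPart_nonneg _, fun i j hij => ?_,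
    fun n => posPart_mono (sub_le_self _ (ht0 n)), fun n => ?_⟩
  · rcases lt_or_gt_of_ne hij with h | h
    · exact key i j h
    · rw [inf_comm]
      exact key j i h
  · refine (norm_posPart_sub_posPart_le _ _).trans ?_
    change ‖v n - (v n - (K⁻¹ * (1 / 2) ^ n) • x)‖ ≤ _
    rw [sub_sub_cancel, norm_smul, Real.norm_of_nonneg (by positivity)]
    calc K⁻¹ * (1 / 2) ^ n * ‖x‖ ≤ K⁻¹ * (1 / 2) ^ n * (2 * B) :=
          mul_le_mul_of_nonneg_left hxB (by positivity)
      _ = 2 * B / K * (1 / 2) ^ n := by rw [div_eq_mul_inv]; ring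

/-- If an operator is null along all disjoint sequences of a bounded solid set of positive
elements, then up to `ε` the set is order bounded as seen by the operator. -/
theorem exists_norm_map_posPart_sub_le {X : Type*} [NormedAddCommGroup X] [NormedSpace ℝ X]
    (L : E →L[ℝ] X) {S : Set E} {B : ℝ} (hS0 : ∀ y ∈ S, 0 ≤ y) (hSB : ∀ y ∈ S, ‖y‖ ≤ B)
    (hS : ∀ y ∈ S, ∀ z, 0 ≤ z → z ≤ y → z ∈ S)
    (hL : ∀ z : ℕ → E, (∀ n, z n ∈ S) → (∀ i j, i ≠ j → z i ⊓ z j = 0) →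
      Tendsto (fun n => L (z n)) atTop (𝓝 0)) {ε : ℝ} (hε : 0 < ε) :
    ∃ u, 0 ≤ u ∧ ∀ y ∈ S, ‖L (y - u)⁺‖ ≤ ε := by
  by_contra! hcon
  choose! g hgS hgε using hcon
  -- If no `u` works, each `y n` is chosen as a counterexample to `4 ^ n` times the sum of its
  -- predecessors, the form required by `exists_disjoint_near` with `K = 1`.
  let s : ℕ → E := fun n => Nat.rec 0 (fun n a => a + g ((1 * 4 ^ n : ℝ) • a)) n
  have hs0 : ∀ n, 0 ≤ s n := fun n => by
    induction n with
    | zero => exact le_rfl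
    | succ n ih => exact add_nonneg ih (hS0 _ (hgS _ (smul_nonneg (by positivity) ih)))
  let y : ℕ → E := fun n => g ((1 * 4 ^ n : ℝ) • s n)
  have hsy : ∀ n, s n = ∑ i ∈ Finset.range n, y i := fun n => by
    induction n with
    | zero => rfl
    | succ n ih => rw [Finset.sum_range_succ, ← ih]
  have hsn : ∀ n : ℕ, 0 ≤ (1 * 4 ^ n : ℝ) • s n := fun n => smul_nonneg (by positivity) (hs0 n)
  have hyS : ∀ n, y n ∈ S := fun n => hgS _ (hsn n)
  obtain ⟨z, hz0, hzd, hzle, hznear⟩ := exists_disjoint_near (y := y) (B := B) (K := 1)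
    (fun n => hS0 _ (hyS n)) (fun n => hSB _ (hyS n)) one_pos
  simp only [← hsy] at hzle hznear
  have hzS : ∀ n, z n ∈ S := fun n => hS _ (hyS n) _ (hz0 n) ((hzle n).trans (by
    rw [posPart_def]
    exact sup_le (sub_le_self _ (hsn n)) (hS0 _ (hyS n))))
  have h1 : Tendsto (fun n => (y n - (1 * 4 ^ n : ℝ) • s n)⁺ - z n) atTop (𝓝 0) := by
    refine squeeze_zero_norm hznear ?_
    simpa using (tendsto_pow_atTop_nhds_zero_of_lt_one (r := (1 / 2 : ℝ)) (by norm_num)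
        (by norm_num)).const_mul (2 * B / 1)
  have h2 : Tendsto (fun n => L (y n - (1 * 4 ^ n : ℝ) • s n)⁺) atTop (𝓝 0) := by
    have := ((L.continuous.tendsto 0).comp h1).add (by simpa using hL z hzS hzd)
    simpa [Function.comp_def] using this
  have h3 := ge_of_tendsto' h2.norm fun n => (hgε _ (hsn n)).le
  rw [norm_zero] at h3
  linarith

end Disjointification

/-! ### Perturbation of disjoint sequences -/

section Operators

variable {E : Type*} [NormedAddCommGroup E] [NormedSpace ℝ E] [CompleteSpace E]
    [Lattice E] [IsOrderedAddMonoid E] [IsOrderedModule ℝ E] [HasSolidNorm E]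

/-- A bounded positive sequence that is null below every positive element has a subsequence close
to a disjoint sequence. -/
theorem exists_subseq_near_disjoint {y : ℕ → E} {B η : ℝ} (hy : ∀ n, 0 ≤ y n)
    (hB : ∀ n, ‖y n‖ ≤ B) (hinf : ∀ u, 0 ≤ u → Tendsto (fun n => y n ⊓ u) atTop (𝓝 0))
    (hη : 0 < η) :
    ∃ φ : ℕ → ℕ, StrictMono φ ∧ ∃ z : ℕ → E, (∀ n, 0 ≤ z n) ∧
      (∀ i j, i ≠ j → z i ⊓ z j = 0) ∧ ∀ n, ‖y (φ n) - z n‖ ≤ η * (1 / 2) ^ n := by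
  have hB0 : 0 ≤ B := (norm_nonneg _).trans (hB 0)
  -- Chosen so that `2 * B / K ≤ η / 2`; the `+ 1` keeps `K` positive when `B = 0`.
  set K : ℝ := 4 * (B + 1) / η with hK
  have hK0 : 0 < K := by positivity
  have hex : ∀ (k N : ℕ) (u : E), 0 ≤ u → ∃ n, N ≤ n ∧ ‖y n ⊓ u‖ ≤ η / 2 * (1 / 2) ^ k := by
    intro k N u hu
    have h := (hinf u hu).norm
    rw [norm_zero] at h
    exact ((eventually_ge_atTop N).and (h.eventually_le_const (by positivity))).exists
  choose! g hgN hg using hex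
  -- The recursion carries the least index still allowed and the sum of the terms already chosen.
  let p : ℕ → ℕ × E := fun n => Nat.rec (0, 0)
    (fun n a => (g n a.1 ((K * 4 ^ n) • a.2) + 1, a.2 + y (g n a.1 ((K * 4 ^ n) • a.2)))) n
  let φ : ℕ → ℕ := fun n => g n (p n).1 ((K * 4 ^ n) • (p n).2)
  have hp2 : ∀ n, (p n).2 = ∑ i ∈ Finset.range n, y (φ i) := fun n => by
    induction n with
    | zero => rfl
    | succ n ih => rw [Finset.sum_range_succ, ← ih]
  have hp0 : ∀ n : ℕ, 0 ≤ (K * 4 ^ n) • (p n).2 := fun n => by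
    rw [hp2]
    exact smul_nonneg (by positivity) (Finset.sum_nonneg fun i _ => hy _)
  have hφ : StrictMono φ := strictMono_nat_of_lt_succ fun n =>
    Nat.lt_of_succ_le (hgN (n + 1) (p (n + 1)).1 _ (hp0 (n + 1)))
  obtain ⟨z, hz0, hzd, -, hzn⟩ := exists_disjoint_near (y := fun n => y (φ n)) (B := B) (K := K)
    (fun n => hy _) (fun n => hB _) hK0
  refine ⟨φ, hφ, z, hz0, hzd, fun n => ?_⟩
  have h1 := hzn n
  rw [← hp2] at h1
  have h2 : ‖y (φ n) ⊓ ((K * 4 ^ n) • (p n).2)‖ ≤ η / 2 * (1 / 2) ^ n := hg n _ _ (hp0 n)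
  rw [inf_eq_sub_posPart_sub] at h2
  have h3 : 2 * B / K ≤ η / 2 := by
    rw [hK, div_div_eq_mul_div, div_le_iff₀ (by positivity)]
    nlinarith
  calc ‖y (φ n) - z n‖ = ‖(y (φ n) - (y (φ n) - (K * 4 ^ n) • (p n).2)⁺) +
        ((y (φ n) - (K * 4 ^ n) • (p n).2)⁺ - z n)‖ := by rw [sub_add_sub_cancel]
    _ ≤ η / 2 * (1 / 2) ^ n + 2 * B / K * (1 / 2) ^ n := norm_add_le_of_le h2 h1
    _ ≤ η / 2 * (1 / 2) ^ n + η / 2 * (1 / 2) ^ n := by gcongr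
    _ = η * (1 / 2) ^ n := by ring

/-- Disjoint sequences are 1-unconditional: the modulus of a combination depends only on the moduli
of the coefficients. -/
theorem norm_sum_smul_le_of_abs_le {z : ℕ → E} (hz : ∀ n, 0 ≤ z n)
    (hd : ∀ i j, i ≠ j → z i ⊓ z j = 0) {a b : ℕ → ℝ} (s : Finset ℕ)
    (hab : ∀ n ∈ s, |a n| ≤ |b n|) : ‖∑ n ∈ s, a n • z n‖ ≤ ‖∑ n ∈ s, b n • z n‖ := by
  refine norm_le_norm_of_abs_le_abs ?_
  rw [abs_sum_smul_of_disjoint hz hd, abs_sum_smul_of_disjoint hz hd]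
  exact Finset.sum_le_sum fun n hn => smul_le_smul_of_nonneg_right (hab n hn) (hz n)

theorem abs_mul_norm_le_norm_sum {z : ℕ → E} (hz : ∀ n, 0 ≤ z n)
    (hd : ∀ i j, i ≠ j → z i ⊓ z j = 0) (a : ℕ → ℝ) {s : Finset ℕ} {k : ℕ} (hk : k ∈ s) :
    |a k| * ‖z k‖ ≤ ‖∑ n ∈ s, a n • z n‖ := by
  have h : ‖a k • z k‖ = |a k| * ‖z k‖ := by rw [norm_smul, Real.norm_eq_abs]
  rw [← h]
  refine norm_le_norm_of_abs_le_abs ?_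
  rw [abs_sum_smul_of_disjoint hz hd, abs_smul_eq, abs_of_nonneg (hz k)]
  exact Finset.single_le_sum (f := fun n => |a n| • z n)
    (fun n _ => smul_nonneg (abs_nonneg _) (hz n)) hk

/-- Small perturbations of a disjoint sequence that is bounded away from zero dominate it. -/
theorem norm_sum_smul_le_two_mul {y z : ℕ → E} {δ : ℝ} (hz : ∀ n, 0 ≤ z n)
    (hd : ∀ i j, i ≠ j → z i ⊓ z j = 0) (hzδ : ∀ n, δ ≤ ‖z n‖)
    (hyz : ∀ n, ‖y n - z n‖ ≤ δ / 4 * (1 / 2) ^ n) (a : ℕ → ℝ) (s : Finset ℕ) :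
    ‖∑ n ∈ s, a n • z n‖ ≤ 2 * ‖∑ n ∈ s, a n • y n‖ := by
  set R := ‖∑ n ∈ s, a n • z n‖ with hR
  -- Each coefficient satisfies `|a n| * δ ≤ R`, so the errors sum to at most half of `R` and can be
  -- absorbed.
  have h1 : ‖∑ n ∈ s, a n • (y n - z n)‖ ≤ R / 2 := by
    calc ‖∑ n ∈ s, a n • (y n - z n)‖ ≤ ∑ n ∈ s, R / 4 * (1 / 2) ^ n := by
          refine norm_sum_le_of_le _ fun n hn => ?_
          rw [norm_smul, Real.norm_eq_abs]
          have h2 : |a n| * δ ≤ R := (mul_le_mul_of_nonneg_left (hzδ n) (abs_nonneg _)).trans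
            (abs_mul_norm_le_norm_sum hz hd a hn)
          calc |a n| * ‖y n - z n‖ ≤ |a n| * (δ / 4 * (1 / 2) ^ n) :=
                mul_le_mul_of_nonneg_left (hyz n) (abs_nonneg _)
            _ = |a n| * δ / 4 * (1 / 2) ^ n := by ring
            _ ≤ R / 4 * (1 / 2) ^ n := by gcongr
      _ = R / 4 * ∑ n ∈ s, (1 / 2 : ℝ) ^ n := by rw [Finset.mul_sum]
      _ ≤ R / 4 * 2 := mul_le_mul_of_nonneg_left
          (sum_le_hasSum s (fun n _ => by positivity) hasSum_geometric_two)
          (by rw [hR]; positivity)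
      _ = R / 2 := by ring
  have h3 : ∑ n ∈ s, a n • (y n - z n) = ∑ n ∈ s, a n • y n - ∑ n ∈ s, a n • z n := by
    simp only [smul_sub, Finset.sum_sub_distrib]
  rw [h3] at h1
  have h4 := norm_sub_norm_le (∑ n ∈ s, a n • z n) (∑ n ∈ s, a n • y n)
  rw [norm_sub_rev] at h4
  linarith

theorem disjointSeq_iff_of_nonneg {x : ℕ → E} (hx : ∀ n, 0 ≤ x n) :
    DisjointSeq x ↔ ∀ i j, i ≠ j → x i ⊓ x j = 0 := by
  simp only [DisjointSeq, abs_of_nonneg (hx _)]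

theorem invertibleOn_closedSpan {X Y : Type*} [NormedAddCommGroup X] [NormedSpace ℝ X]
    [NormedAddCommGroup Y] [NormedSpace ℝ Y] (T : X →L[ℝ] Y) {x : ℕ → X} {c : ℝ} (hc : 0 < c)
    (h : ∀ (s : Finset ℕ) (a : ℕ → ℝ),
      c * ‖∑ n ∈ s, a n • x n‖ ≤ ‖∑ n ∈ s, a n • T (x n)‖) :
    InvertibleOn T (closedSpan x) := by
  refine ⟨c, hc, fun v hv => ?_⟩
  have hcl : IsClosed {v | c * ‖v‖ ≤ ‖T v‖} :=
    isClosed_le (continuous_const.mul continuous_norm) T.continuous.norm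
  refine closure_minimal (fun w hw => ?_) hcl hv
  obtain ⟨a, rfl⟩ := Finsupp.mem_span_range_iff_exists_finsupp.1 hw
  simpa [Finsupp.sum, map_sum] using h a.support a

/-! ### Positive operators and the implications -/

theorem IsPositiveOp.map_mono {T : E →L[ℝ] E} (hT : IsPositiveOp T) {a b : E} (h : a ≤ b) :
    T a ≤ T b := by
  have := hT _ (sub_nonneg.2 h)
  rwa [map_sub, sub_nonneg] at this

theorem IsPositiveOp.abs_map_le {T : E →L[ℝ] E} (hT : IsPositiveOp T) (x : E) :
    |T x| ≤ T |x| :=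
  abs_le'.2 ⟨hT.map_mono (le_abs_self x), by rw [← map_neg]; exact hT.map_mono (neg_le_abs x)⟩

theorem IsMWeaklyCompact.isDisjointlyStrictlySingular {T : E →L[ℝ] E} (h : IsMWeaklyCompact T) :
    IsDisjointlyStrictlySingular T := by
  rintro x hx hd ⟨c, hc, hinv⟩
  have hnorm : ∀ n, ‖‖x n‖⁻¹ • x n‖ = 1 := fun n => by
    rw [norm_smul, norm_inv, norm_norm, inv_mul_cancel₀ (norm_ne_zero_iff.2 (hx n))]
  have h0 := (h (fun n => ‖x n‖⁻¹ • x n) (fun n => by simp [hnorm]) fun i j hij => by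
    rw [abs_smul_eq, abs_smul_eq]
    exact smul_inf_smul_eq_zero (abs_nonneg _) (abs_nonneg _) (hd i j hij)).norm
  rw [norm_zero] at h0
  have h1 := ge_of_tendsto' h0 (b := c) fun n => by
    have := hinv (‖x n‖⁻¹ • x n) (Submodule.smul_mem _ _
      (Submodule.le_topologicalClosure _ (Submodule.subset_span ⟨n, rfl⟩)))
    rwa [hnorm, mul_one] at this
  linarith

/-- The image under a positive operator of a bounded disjoint positive sequence is null below every
positive element. -/
theorem IsReflexive.tendsto_map_inf_zero (hE : IsReflexive E) {T : E →L[ℝ] E}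
    (hT : IsPositiveOp T) {x : ℕ → E} {B : ℝ} (hx : ∀ n, 0 ≤ x n) (hB : ∀ n, ‖x n‖ ≤ B)
    (hd : ∀ i j, i ≠ j → x i ⊓ x j = 0) {u : E} (hu : 0 ≤ u) :
    Tendsto (fun n => T (x n) ⊓ u) atTop (𝓝 0) :=
  hE.tendsto_inf_zero (fun n => hT _ (hx n))
    (fun f hf => hE.tendsto_apply_zero_of_disjoint hx hB hd (f.comp T) fun v hv => hf _ (hT v hv))
    hu

theorem IsDisjointlyStrictlySingular.isMWeaklyCompact (hE : IsReflexive E)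
    (hDH : IsDisjointlyHomogeneous E) {T : E →L[ℝ] E} (hT : IsPositiveOp T)
    (h : IsDisjointlyStrictlySingular T) : IsMWeaklyCompact T := by
  intro x hxB hxd
  by_contra hn
  obtain ⟨ε, hε, hfr⟩ : ∃ ε > 0, ∃ᶠ n in atTop, ε ≤ ‖T (x n)‖ := by
    by_contra! hc
    refine hn (Metric.tendsto_nhds.2 fun ε hε => ?_)
    simpa using hc ε hε
  obtain ⟨φ, hφ, hφε⟩ := extraction_of_frequently_atTop hfr
  have hne : ∀ k, 0 < ‖x (φ k)‖ := fun k => norm_pos_iff.2 fun h0 => by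
    have := hφε k
    rw [h0, map_zero, norm_zero] at this
    linarith
  -- Neither change lowers the bound `ε`: `|T x| ≤ T |x|`, and the norms divided by are at most one.
  let w : ℕ → E := fun k => ‖x (φ k)‖⁻¹ • |x (φ k)|
  have hw0 : ∀ k, 0 ≤ w k := fun k => smul_nonneg (by positivity) (abs_nonneg _)
  have hw1 : ∀ k, ‖w k‖ = 1 := fun k => by
    rw [norm_smul, norm_inv, norm_norm, norm_abs_eq_norm, inv_mul_cancel₀ (hne k).ne']
  have hwd : ∀ i j, i ≠ j → w i ⊓ w j = 0 := fun i j hij =>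
    smul_inf_smul_eq_zero (by positivity) (by positivity) (hxd _ _ (hφ.injective.ne hij))
  have hTw : ∀ k, ε ≤ ‖T (w k)‖ := fun k => by
    have h1 : ‖T (x (φ k))‖ ≤ ‖T |x (φ k)|‖ := by
      rw [← norm_abs_eq_norm (T (x (φ k)))]
      exact norm_le_norm_of_nonneg_of_le (abs_nonneg _) (hT.abs_map_le _)
    rw [map_smul, norm_smul, norm_inv, norm_norm]
    refine ((hφε k).trans h1).trans (le_mul_of_one_le_left (norm_nonneg _) ?_)
    exact (one_le_inv₀ (hne k)).2 (mem_closedBall_zero_iff.1 (hxB _))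
  -- The value `ε / 8` is `δ / 4` for the lower bound `δ = ε / 2` on `‖z k‖`.
  obtain ⟨ψ, hψ, z, hz0, hzd, hyz⟩ := exists_subseq_near_disjoint (y := fun k => T (w k))
    (B := ‖T‖) (η := ε / 8) (fun k => hT _ (hw0 k))
    (fun k => (T.le_opNorm _).trans (by rw [hw1, mul_one]))
    (fun u hu => hE.tendsto_map_inf_zero hT hw0 (fun k => (hw1 k).le) hwd hu) (by positivity)
  have hzε : ∀ k, ε / 2 ≤ ‖z k‖ := fun k => by
    have h1 := hyz k
    have h2 : (1 / 2 : ℝ) ^ k ≤ 1 := pow_le_one₀ (by norm_num) (by norm_num)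
    have h3 := norm_sub_norm_le (T (w (ψ k))) (z k)
    have h4 := hTw (ψ k)
    nlinarith
  have hzpos : ∀ k, 0 < ‖z k‖ := fun k => lt_of_lt_of_le (by positivity) (hzε k)
  obtain ⟨C, hC, χ, hχ, hequiv⟩ := hDH (fun k => w (ψ k)) (fun k => ‖z k‖⁻¹ • z k)
    (fun k => hw1 _)
    (fun k => by rw [norm_smul, norm_inv, norm_norm, inv_mul_cancel₀ (hzpos k).ne'])
    ((disjointSeq_iff_of_nonneg fun k => hw0 _).2 fun i j hij => hwd _ _ (hψ.injective.ne hij))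
    ((disjointSeq_iff_of_nonneg fun k => smul_nonneg (by positivity) (hz0 k)).2 fun i j hij =>
      smul_inf_smul_eq_zero (by positivity) (by positivity) (hzd i j hij))
  refine h (fun k => w (ψ (χ k))) (fun k h0 => ?_)
    ((disjointSeq_iff_of_nonneg fun k => hw0 _).2 fun i j hij =>
      hwd _ _ ((hψ.comp hχ).injective.ne hij))
    -- The factors are `C` for homogeneity, `2 / ε` for normalizing `z`, and `2` for replacing `z`
    -- by `T w`.
    (invertibleOn_closedSpan T (c := (C * (4 / ε))⁻¹) (by positivity) fun s a => ?_)
  · have := hw1 (ψ (χ k))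
    rw [h0, norm_zero] at this
    exact zero_ne_one this
  have hz0' : ∀ k, 0 ≤ z (χ k) := fun k => hz0 _
  have hzd' : ∀ i j, i ≠ j → z (χ i) ⊓ z (χ j) = 0 := fun i j hij => hzd _ _ (hχ.injective.ne hij)
  have h1 := (hequiv s a).2
  have h2 : ‖∑ n ∈ s, a n • (‖z (χ n)‖⁻¹ • z (χ n))‖ ≤ 2 / ε * ‖∑ n ∈ s, a n • z (χ n)‖ := by
    have e : 2 / ε * ‖∑ n ∈ s, a n • z (χ n)‖ = ‖∑ n ∈ s, (2 / ε * a n) • z (χ n)‖ := by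
      simp only [← smul_smul, ← Finset.smul_sum]
      rw [norm_smul, Real.norm_of_nonneg (by positivity)]
    rw [e]
    simp only [smul_smul]
    refine norm_sum_smul_le_of_abs_le hz0' hzd' s fun n _ => ?_
    rw [abs_mul, abs_mul, mul_comm, abs_of_nonneg (a := 2 / ε) (by positivity), abs_inv, abs_norm]
    refine mul_le_mul_of_nonneg_right ?_ (abs_nonneg _)
    rw [← inv_div ε 2]
    exact inv_anti₀ (by positivity) (hzε _)
  have h3 := norm_sum_smul_le_two_mul (y := fun k => T (w (ψ (χ k)))) (δ := ε / 2)
    hz0' hzd' (fun n => hzε _) (fun n => (hyz (χ n)).trans (by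
      rw [div_div]
      norm_num only
      exact mul_le_mul_of_nonneg_left (pow_le_pow_of_le_one (by norm_num) (by norm_num)
        (hχ.le_apply)) (by positivity))) a s
  rw [inv_mul_le_iff₀ (by positivity)]
  calc ‖∑ n ∈ s, a n • w (ψ (χ n))‖ ≤ C * ‖∑ n ∈ s, a n • (‖z (χ n)‖⁻¹ • z (χ n))‖ := h1
    _ ≤ C * (2 / ε * (2 * ‖∑ n ∈ s, a n • T (w (ψ (χ n)))‖)) := by
        refine mul_le_mul_of_nonneg_left (h2.trans ?_) hC.le
        exact mul_le_mul_of_nonneg_left h3 (by positivity)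
    _ = C * (4 / ε) * ‖∑ n ∈ s, a n • T (w (ψ (χ n)))‖ := by ring

theorem tendsto_zero_of_abs {y : ℕ → E} (h : Tendsto (fun n => |y n|) atTop (𝓝 0)) :
    Tendsto y atTop (𝓝 0) := by
  rw [tendsto_zero_iff_norm_tendsto_zero] at h ⊢
  simpa only [norm_abs_eq_norm] using h

/-- Up to `ε`, `|y n|` is bounded by its truncation at a fixed `T u`, and these truncations form an
order bounded disjoint sequence. -/
theorem IsMWeaklyCompact.isLWeaklyCompact (hE : IsReflexive E) {T : E →L[ℝ] E}
    (hT : IsPositiveOp T) (h : IsMWeaklyCompact T) : IsLWeaklyCompact T := by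
  intro y hy hyd
  refine tendsto_zero_of_abs (Metric.tendsto_nhds.2 fun ε hε => ?_)
  obtain ⟨u, hu0, hu⟩ := exists_norm_map_posPart_sub_le T (S := {x | 0 ≤ x ∧ ‖x‖ ≤ 1}) (B := 1)
    (fun x hx => hx.1) (fun x hx => hx.2)
    (fun x hx z hz hzx => ⟨hz, (norm_le_norm_of_nonneg_of_le hz hzx).trans hx.2⟩)
    (fun z hz hzd => h z (fun n => mem_closedBall_zero_iff.2 (hz n).2)
      ((disjointSeq_iff_of_nonneg fun n => (hz n).1).2 hzd)) (half_pos hε)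
  have h0 : Tendsto (fun n => |y n| ⊓ T u) atTop (𝓝 0) :=
    hE.tendsto_zero_of_disjoint_of_le (fun n => le_inf (abs_nonneg _) (hT u hu0))
      (fun n => inf_le_right) fun i j hij =>
        inf_eq_zero_mono (hyd i j hij) (le_inf (abs_nonneg _) (hT u hu0))
          (le_inf (abs_nonneg _) (hT u hu0)) inf_le_left inf_le_left
  have h1 := h0.norm
  rw [norm_zero] at h1
  filter_upwards [h1.eventually_lt_const (half_pos hε)] with n hn
  obtain ⟨_, ⟨x, hx, rfl⟩, hyx⟩ := hy n
  have h2 : |y n| ≤ T u + T (|x| - u)⁺ := by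
    refine (hyx.trans (hT.abs_map_le x)).trans ?_
    rw [← map_add]
    refine hT.map_mono ?_
    rw [← sub_le_iff_le_add']
    exact le_posPart _
  have h3 := le_inf_add_of_le_add (hT _ (posPart_nonneg _)) h2
  have h4 := hu |x| ⟨abs_nonneg x, by rw [norm_abs_eq_norm]; exact mem_closedBall_zero_iff.1 hx⟩
  rw [dist_zero_right]
  calc ‖|y n|‖ ≤ ‖|y n| ⊓ T u + T (|x| - u)⁺‖ := norm_le_norm_of_nonneg_of_le (abs_nonneg _) h3
    _ ≤ ‖|y n| ⊓ T u‖ + ‖T (|x| - u)⁺‖ := norm_add_le _ _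
    _ < ε := by linarith

theorem IsLWeaklyCompact.isMWeaklyCompact (hE : IsReflexive E) {T : E →L[ℝ] E}
    (hT : IsPositiveOp T) (h : IsLWeaklyCompact T) : IsMWeaklyCompact T := by
  intro x hx hxd
  have hx1 : ∀ n, ‖|x n|‖ ≤ 1 := fun n => by
    rw [norm_abs_eq_norm]; exact mem_closedBall_zero_iff.1 (hx n)
  suffices hs : Tendsto (fun n => T |x n|) atTop (𝓝 0) by
    have h1 := hs.norm
    rw [norm_zero] at h1
    refine squeeze_zero_norm (fun n => ?_) h1
    rw [← norm_abs_eq_norm (T (x n))]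
    exact norm_le_norm_of_nonneg_of_le (abs_nonneg _) (hT.abs_map_le _)
  refine Metric.tendsto_nhds.2 fun ε hε => ?_
  -- Here the identity is the operator and the solid hull itself is almost order bounded; the
  -- truncations `T |x n| ⊓ u` vanish by weak nullity.
  obtain ⟨u, hu0, hu⟩ := exists_norm_map_posPart_sub_le (ContinuousLinearMap.id ℝ E) (B := ‖T‖)
    (S := {y | 0 ≤ y ∧
      y ∈ LatticeOrderedAddCommGroup.solidClosure (T '' Metric.closedBall (0 : E) 1)})
    (fun y hy => hy.1)
    (by
      rintro y ⟨-, _, ⟨v, hv, rfl⟩, hyv⟩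
      exact (norm_le_norm_of_abs_le_abs hyv).trans
        ((T.le_opNorm v).trans (mul_le_of_le_one_right (norm_nonneg _)
          (mem_closedBall_zero_iff.1 hv))))
    (fun y hy z hz hzy => ⟨hz, LatticeOrderedAddCommGroup.isSolid_solidClosure _ hy.2
      (abs_le_abs_of_nonneg hz hzy)⟩)
    (fun z hz hzd => h z (fun n => (hz n).2)
      ((disjointSeq_iff_of_nonneg fun n => (hz n).1).2 hzd)) (half_pos hε)
  have h1 := (hE.tendsto_map_inf_zero hT (fun n => abs_nonneg (x n)) hx1 hxd hu0).norm
  rw [norm_zero] at h1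
  filter_upwards [h1.eventually_lt_const (half_pos hε)] with n hn
  have hTx := hT _ (abs_nonneg (x n))
  have h2 : ‖(T |x n| - u)⁺‖ ≤ ε / 2 := hu (T |x n|) ⟨hTx, T |x n|,
    ⟨|x n|, mem_closedBall_zero_iff.2 (hx1 n), rfl⟩, le_rfl⟩
  have h3 : T |x n| ≤ T |x n| ⊓ u + (T |x n| - u)⁺ := by
    rw [inf_eq_sub_posPart_sub, sub_add_cancel]
  rw [dist_zero_right]
  calc ‖T |x n|‖ ≤ ‖T |x n| ⊓ u + (T |x n| - u)⁺‖ := norm_le_norm_of_nonneg_of_le hTx h3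
    _ ≤ ‖T |x n| ⊓ u‖ + ‖(T |x n| - u)⁺‖ := norm_add_le _ _
    _ < ε := by linarith

end Operators

end DHLattice

theorem mainTheorem2 {E : Type*} [NormedAddCommGroup E] [NormedSpace ℝ E] [CompleteSpace E]
    [Lattice E] [IsOrderedAddMonoid E] [IsOrderedModule ℝ E] [HasSolidNorm E]
    (hrefl : DHLattice.IsReflexive E) (hDH : DHLattice.IsDisjointlyHomogeneous E)
    (T : E →L[ℝ] E) (hT : DHLattice.IsPositiveOp T) :
    List.TFAE [DHLattice.IsDisjointlyStrictlySingular T,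
      DHLattice.IsMWeaklyCompact T,
      DHLattice.IsLWeaklyCompact T] := by
  tfae_have 1 → 2 := fun h => h.isMWeaklyCompact hrefl hDH hT
  tfae_have 2 → 1 := fun h => h.isDisjointlyStrictlySingular
  tfae_have 2 → 3 := fun h => h.isLWeaklyCompact hrefl hT
  tfae_have 3 → 2 := fun h => h.isMWeaklyCompact hrefl hT
  tfae_finish
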